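/- Let $K$ be a field, $S=K[x_1,\dots,x_n]$, $\mathfrak m=(x_1,\dots,x_n)$. For a monomial ideal $I\subseteq S$ let $\mathcal G(I)$ be its set of minimal monomial generators and let $$\partial(I)=\Big(\tfrac{\partial u}{\partial x_i}: u\in\mathcal G(I),\ 1\le i\le n\Big),\qquad \partial^*(I)=(u/x_i: u\in\mathcal G(I),\ x_i\mid u);$$ put $\partial^0(I)=I$ and $\partial^{\ell}(I)=\partial(\partial^{\ell-1}(I))$ for $\ell\ge1$. (One has $\partial(I)=\partial^*(I)$ if $\operatorname{char}K=0$ or if $\operatorname{char}K$ is larger than every exponent occurring in $\mathcal G(I)$.) For a monomial $u\neq1$ let $\max(u)=\max\{i:x_i\mid u\}$. A monomial ideal $I$ is stable if $x_i(u/x_{\max(u)})\in I$ for all monomials $u\in I$, $u\ne1$, and all $i<\max(u)$; it is strongly stable if $x_i(u/x_j)\in I$ for all monomials $u\in I$ and all $i<j$ with $x_j\mid u$. Let $\operatorname{reg}I=\max\{j-i:\operatorname{Tor}_i^S(K,I)_j\neq0\}$ and $\alpha(I)=\min\{d:(I/\mathfrak mI)_d\ne0\}$, $\omega(I)=\max\{d:(I/\mathfrak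 mI)_d\neq0\}$ for $I\ne0$. The ideal $I\ne0$ is equigenerated if $\alpha(I)=\omega(I)$, and has linear resolution if $\operatorname{reg}I=\omega(I)=\alpha(I)$. It has differential linear resolution if $\partial^\ell(I)$ has linear resolution for all $0\le\ell\le\alpha(I)$. **Proposition.** Let $I\subseteq S$ be a monomial ideal with $\partial(I)=\partial^*(I)$. 1. If $I$ is stable (respectively strongly stable), then $\partial(I)$ is stable (respectively strongly stable). 2. If $I$ is stable or strongly stable and $I\neq0$, $I\ne S$, then $\operatorname{reg}\partial(I)\le\operatorname{reg}I$. 3. If $I$ is stable or strongly stable, equigenerated (in degree $d$, say), and $\partial(\partial^\ell(I))=\partial^*(\partial^\ell(I))$ for all $0\le\ell<d$, then $I$ has differential linear resolution. -/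

import Mathlib

open MvPolynomial

noncomputable section

namespace MonomialGradient

variable {K : Type*} [Field K] {n : ℕ}

/-! ### Monomial ideals, stable ideals, gradient ideals

The monomial `x^u` with exponent vector `u : Fin n →₀ ℕ` is `monomial u 1`. -/

/-- A monomial ideal: an ideal generated by monomials. -/
def IsMonomialIdeal (I : Ideal (MvPolynomial (Fin n) K)) : Prop :=
  ∃ A : Set (Fin n →₀ ℕ), I = Ideal.span ((fun u => monomial u (1 : K)) '' A)

/-- Exponent vectors of the minimal monomial generators of a monomial ideal `I`: the monomials
in `I` that are minimal for divisibility (`x^u ∣ x^v` if and only if `u ≤ v`). -/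
def minGens (I : Ideal (MvPolynomial (Fin n) K)) : Set (Fin n →₀ ℕ) :=
  {u | Minimal (fun v => monomial v (1 : K) ∈ I) u}

/-- The gradient ideal of a monomial ideal: the ideal generated by all the partial derivatives of
its minimal monomial generators. -/
def gradientIdeal (I : Ideal (MvPolynomial (Fin n) K)) : Ideal (MvPolynomial (Fin n) K) :=
  Ideal.span {f | ∃ u ∈ minGens I, ∃ i, f = pderiv i (monomial u (1 : K))}

/-- The ideal generated by the monomials `x^u / x_i`, where `x^u` is a minimal monomial generator
of `I` and `x_i` divides `x^u`. -/
def starGradientIdeal (I : Ideal (MvPolynomial (Fin n) K)) : Ideal (MvPolynomial (Fin n) K) :=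
  Ideal.span {f | ∃ u ∈ minGens I, ∃ i ∈ u.support, f = monomial (u - Finsupp.single i 1) (1 : K)}

/-- A stable ideal: a monomial ideal such that `x_i (x^u / x_m) ∈ I` for every monomial
`x^u ∈ I`, `x^u ≠ 1`, with `m = max(u)` the largest index in the support of `u`, and all `i < m`.
(For `x^u = 1` there is no such `m`.) -/
structure IsStable (I : Ideal (MvPolynomial (Fin n) K)) : Prop where
  isMonomialIdeal : IsMonomialIdeal I
  exchange : ∀ u : Fin n →₀ ℕ, monomial u (1 : K) ∈ I →
    ∀ m : Fin n, IsGreatest (u.support : Set (Fin n)) m → ∀ i < m,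
      monomial (u - Finsupp.single m 1 + Finsupp.single i 1) (1 : K) ∈ I

/-- A strongly stable ideal: a monomial ideal such that `x_i (x^u / x_j) ∈ I` for every monomial
`x^u ∈ I` and all `i < j` such that `x_j` divides `x^u`. -/
structure IsStronglyStable (I : Ideal (MvPolynomial (Fin n) K)) : Prop where
  isMonomialIdeal : IsMonomialIdeal I
  exchange : ∀ u : Fin n →₀ ℕ, monomial u (1 : K) ∈ I →
    ∀ j ∈ u.support, ∀ i < j,
      monomial (u - Finsupp.single j 1 + Finsupp.single i 1) (1 : K) ∈ I

/-- In characteristic zero, or if the characteristic is larger than every exponent in the minimal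
monomial generators (more generally, if it divides no positive such exponent), the two ideals
agree. -/
theorem gradientIdeal_eq_starGradientIdeal (I : Ideal (MvPolynomial (Fin n) K))
    (h : ∀ u ∈ minGens I, ∀ i ∈ u.support, ((u i : ℕ) : K) ≠ 0) :
    gradientIdeal I = starGradientIdeal I := by
  apply le_antisymm
  · refine Ideal.span_le.2 ?_
    rintro f ⟨u, hu, i, rfl⟩
    rw [pderiv_monomial, one_mul]
    by_cases hi : i ∈ u.support
    · have : monomial (u - Finsupp.single i 1) ((u i : ℕ) : K)
          = C ((u i : ℕ) : K) * monomial (u - Finsupp.single i 1) (1 : K) := by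
        rw [C_mul_monomial, mul_one]
      rw [this]
      exact Ideal.mul_mem_left _ _ (Ideal.subset_span ⟨u, hu, i, hi, rfl⟩)
    · have : u i = 0 := by simpa using hi
      simp [this]
  · refine Ideal.span_le.2 ?_
    rintro f ⟨u, hu, i, hi, rfl⟩
    have : monomial (u - Finsupp.single i 1) (1 : K)
        = C ((u i : ℕ) : K)⁻¹ * pderiv i (monomial u (1 : K)) := by
      rw [pderiv_monomial, C_mul_monomial, one_mul, inv_mul_cancel₀ (h u hu i hi)]
    rw [this]
    exact Ideal.mul_mem_left _ _ (Ideal.subset_span ⟨u, hu, i, rfl⟩)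

/-! ### The Koszul resolution of `K`

The Koszul complex on `x_1, …, x_n` over `S = K[x_1, …, x_n]` has as its `i`-th term the free
module with basis `e_F`, `F ⊆ {1, …, n}`, `|F| = i`, where `e_F` has internal degree `|F|`. The
function `f` stands for `∑_F f(F) e_F`. -/

/-- The sign `(-1) ^ |{q ∈ F : q < p}|`. -/
def koszulSign (p : Fin n) (F : Finset (Fin n)) : MvPolynomial (Fin n) K :=
  (-1) ^ (F.filter (· < p)).card

variable (K n) in
/-- The Koszul differential `e_F ↦ ∑_{p ∈ F} (-1)^|{q ∈ F : q < p}| x_p e_{F \ {p}}`, read off at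
the coefficient of `e_G`. -/
def koszulD : (Finset (Fin n) → MvPolynomial (Fin n) K) →ₗ[MvPolynomial (Fin n) K]
    (Finset (Fin n) → MvPolynomial (Fin n) K) where
  toFun f G := ∑ p ∈ Gᶜ, koszulSign p G * X p * f (insert p G)
  map_add' f g := by
    funext G
    simp [mul_add, Finset.sum_add_distrib]
  map_smul' c f := by
    funext G
    simp only [Pi.smul_apply, smul_eq_mul, RingHom.id_apply, Finset.mul_sum]
    exact Finset.sum_congr rfl fun p _ => by ring

theorem koszulD_apply (f : Finset (Fin n) → MvPolynomial (Fin n) K) (G : Finset (Fin n)) :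
    koszulD K n f G = ∑ p ∈ Gᶜ, koszulSign p G * X p * f (insert p G) := rfl

theorem koszulSign_insert (p q : Fin n) (G : Finset (Fin n)) (hp : p ∉ G) :
    (koszulSign q (insert p G) : MvPolynomial (Fin n) K)
      = if p < q then -koszulSign q G else koszulSign q G := by
  unfold koszulSign
  rw [Finset.filter_insert]
  split_ifs with h
  · rw [Finset.card_insert_of_notMem (by simp [hp]), pow_succ]
    ring
  · rfl

/-- The Koszul complex is a complex. -/
theorem koszulD_koszulD (f : Finset (Fin n) → MvPolynomial (Fin n) K) :
    koszulD K n (koszulD K n f) = 0 := by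
  funext G
  simp only [koszulD_apply, Finset.mul_sum, Pi.zero_apply]
  rw [Finset.sum_sigma']
  refine Finset.sum_involution (fun a _ => ⟨a.2, a.1⟩) ?_ ?_ ?_ ?_
  · rintro ⟨p, q⟩ h
    simp only [Finset.mem_sigma, Finset.mem_compl, Finset.mem_insert, not_or] at h
    obtain ⟨hp, hqp, hq⟩ := h
    simp only
    rw [koszulSign_insert p q G hp, koszulSign_insert q p G hq, Finset.insert_comm q p G]
    rcases lt_or_gt_of_ne hqp with h | h
    · rw [if_neg h.not_gt, if_pos h]
      ring
    · rw [if_pos h, if_neg h.not_gt]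
      ring
  · rintro ⟨p, q⟩ h _ h2
    simp only [Finset.mem_sigma, Finset.mem_compl, Finset.mem_insert, not_or] at h
    simp only [Sigma.mk.injEq, heq_eq_eq] at h2
    exact h.2.1 h2.1
  · rintro ⟨p, q⟩ h
    simp only [Finset.mem_sigma, Finset.mem_compl, Finset.mem_insert, not_or] at h ⊢
    exact ⟨h.2.2, fun e => h.2.1 e.symm, h.1⟩
  · rintro ⟨p, q⟩ _
    rfl

/-- An operator used for the contracting homotopy of the Koszul complex. -/
theorem exists_koszulDiv (p : Fin n) (g : MvPolynomial (Fin n) K) :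
    ∃ h : MvPolynomial (Fin n) K, ∀ a : Fin n →₀ ℕ,
      coeff a h = if ∀ q < p, a q = 0 then coeff (a + Finsupp.single p 1) g else 0 := by
  classical
  refine ⟨∑ b ∈ g.support, if b p ≠ 0 ∧ ∀ q < p, b q = 0 then
    monomial (b - Finsupp.single p 1) (coeff b g) else 0, fun a => ?_⟩
  rw [coeff_sum]
  have hap : (a + Finsupp.single p 1 : Fin n →₀ ℕ) p ≠ 0 := by simp
  have haq : (∀ q < p, (a + Finsupp.single p 1 : Fin n →₀ ℕ) q = 0) ↔ ∀ q < p, a q = 0 := by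
    refine forall₂_congr fun q hq => ?_
    rw [Finsupp.add_apply, Finsupp.single_eq_of_ne hq.ne, add_zero]
  rw [Finset.sum_eq_single (a + Finsupp.single p 1)]
  · rw [apply_ite (coeff a), coeff_monomial, add_tsub_cancel_right, if_pos rfl, coeff_zero]
    simp only [haq, hap, ne_eq, not_false_eq_true, true_and]
  · intro b _ hne
    split_ifs with hb
    · rw [coeff_monomial, if_neg]
      rintro rfl
      refine hne ?_
      rw [tsub_add_cancel_of_le]
      exact Finsupp.single_le_iff.2 (Nat.one_le_iff_ne_zero.2 hb.1)
    · exact coeff_zero _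
  · intro h
    rw [notMem_support_iff.1 h]
    simp

theorem coeff_koszulD (f : Finset (Fin n) → MvPolynomial (Fin n) K) (G : Finset (Fin n))
    (a : Fin n →₀ ℕ) :
    coeff a (koszulD K n f G) = ∑ p ∈ Gᶜ, if p ∈ a.support then
      (-1) ^ (G.filter (· < p)).card * coeff (a - Finsupp.single p 1) (f (insert p G)) else 0 := by
  rw [koszulD_apply, coeff_sum]
  refine Finset.sum_congr rfl fun p _ => ?_
  have : (koszulSign p G : MvPolynomial (Fin n) K) = C ((-1) ^ (G.filter (· < p)).card) := by
    simp [koszulSign]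
  rw [this, mul_assoc, coeff_C_mul, coeff_X_mul', mul_ite, mul_zero]

/-- The Koszul complex is a free resolution of `K = S / (x_1, …, x_n)`: its cycles with zero
constant term in homological degree zero are exactly its boundaries. -/
theorem koszulD_eq_zero_and_iff (f : Finset (Fin n) → MvPolynomial (Fin n) K) :
    (koszulD K n f = 0 ∧ coeff 0 (f ∅) = 0) ↔ ∃ g, koszulD K n g = f := by
  constructor
  swap
  · rintro ⟨g, rfl⟩
    refine ⟨koszulD_koszulD g, ?_⟩
    rw [coeff_koszulD]
    simp
  rintro ⟨hf, hf0⟩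
  choose D hD using exists_koszulDiv (K := K) (n := n)
  obtain ⟨H, hmin⟩ : ∃ H : Finset (Fin n) → MvPolynomial (Fin n) K, ∀ G, ∀ p ∈ G,
      (∀ q ∈ G, p ≤ q) → H G = D p (f (G.erase p)) := by
    refine ⟨fun G => if h : G.Nonempty then D (G.min' h) (f (G.erase (G.min' h))) else 0, ?_⟩
    intro G p hp hle
    have hG : G.Nonempty := ⟨p, hp⟩
    have : G.min' hG = p := le_antisymm (Finset.min'_le _ _ hp) (Finset.le_min' _ _ _ hle)
    simp only [dif_pos hG, this]
  refine ⟨H, ?_⟩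
  funext G
  ext a
  rw [coeff_koszulD]
  rcases (G ∪ a.support).eq_empty_or_nonempty with h0 | hne
  · rw [Finset.union_eq_empty, Finsupp.support_eq_empty] at h0
    obtain ⟨rfl, rfl⟩ := h0
    simp [hf0]
  obtain ⟨r, hr, hrmin⟩ : ∃ r ∈ G ∪ a.support, ∀ q ∈ G ∪ a.support, r ≤ q :=
    ⟨_, Finset.min'_mem _ hne, fun q hq => Finset.min'_le _ _ hq⟩
  have hra : ∀ q < r, a q = 0 := by
    intro q hq
    by_contra h
    exact (hrmin q (Finset.mem_union_right _ (Finsupp.mem_support_iff.2 h))).not_gt hq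
  have hrG : ∀ q ∈ G, r ≤ q := fun q hq => hrmin q (Finset.mem_union_left _ hq)
  by_cases hrmem : r ∈ G
  · have e := congrArg (coeff (a + Finsupp.single r 1)) (congrFun hf (G.erase r))
    rw [coeff_koszulD, Finset.compl_erase, Finset.sum_insert (by simpa using hrmem)] at e
    have hfil : (G.erase r).filter (· < r) = ∅ := by
      ext q
      simp only [Finset.mem_filter, Finset.mem_erase, Finset.notMem_empty, iff_false, not_and,
        not_lt]
      exact fun h => hrG q h.2
    rw [if_pos (by simp), Finset.insert_erase hrmem, add_tsub_cancel_right, hfil] at e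
    simp only [Finset.card_empty, pow_zero, one_mul, Pi.zero_apply, coeff_zero] at e
    rw [eq_neg_of_add_eq_zero_left e, ← Finset.sum_neg_distrib]
    refine Finset.sum_congr rfl fun p hp => ?_
    have hpG : p ∉ G := Finset.mem_compl.1 hp
    have hpr : p ≠ r := fun h => hpG (h ▸ hrmem)
    have hsupp : p ∈ (a + Finsupp.single r 1).support ↔ p ∈ a.support := by
      simp [Finsupp.single_eq_of_ne hpr]
    simp only [hsupp]
    split_ifs with hpa
    · have hrp : r < p := lt_of_le_of_ne (hrmin p (Finset.mem_union_right _ hpa)) hpr.symm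
      rw [hmin (insert p G) r (Finset.mem_insert_of_mem hrmem)
        (by simpa using ⟨hrp.le, hrG⟩), hD, if_pos, Finset.erase_insert_of_ne hpr]
      · have h1 : G.filter (· < p) = insert r ((G.erase r).filter (· < p)) := by
          ext q
          by_cases hq : q = r
          · simp [hq, hrmem, hrp]
          · simp [hq]
        have h2 : a - Finsupp.single p 1 + Finsupp.single r 1
            = a + Finsupp.single r 1 - Finsupp.single p 1 := by
          have : Finsupp.single p 1 ≤ a :=
            Finsupp.single_le_iff.2 (Nat.one_le_iff_ne_zero.2 (Finsupp.mem_support_iff.1 hpa))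
          rw [tsub_add_eq_add_tsub this]
        rw [h1, Finset.card_insert_of_notMem (by simp), h2, pow_succ]
        ring
      · intro q hq
        rw [Finsupp.tsub_apply, hra q hq, zero_tsub]
    · exact neg_zero.symm
  · have hrs : r ∈ a.support := by
      rcases Finset.mem_union.1 hr with h | h
      · exact absurd h hrmem
      · exact h
    have hlt : ∀ q ∈ G, r < q := fun q hq =>
      lt_of_le_of_ne (hrG q hq) fun h => hrmem (h ▸ hq)
    rw [Finset.sum_eq_single_of_mem r (Finset.mem_compl.2 hrmem)]
    · have hfil : G.filter (· < r) = ∅ := by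
        ext q
        simp only [Finset.mem_filter, Finset.notMem_empty, iff_false, not_and, not_lt]
        exact fun h => hrG q h
      rw [if_pos hrs, hmin (insert r G) r (Finset.mem_insert_self _ _)
        (by simpa using hrG), hD, if_pos, Finset.erase_insert hrmem, tsub_add_cancel_of_le, hfil]
      · simp
      · exact Finsupp.single_le_iff.2 (Nat.one_le_iff_ne_zero.2 (Finsupp.mem_support_iff.1 hrs))
      · intro q hq
        rw [Finsupp.tsub_apply, hra q hq, zero_tsub]
    · intro p hp hpr
      split_ifs with hpa
      · have hrp : r < p := lt_of_le_of_ne (hrmin p (Finset.mem_union_right _ hpa)) hpr.symm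
        have hne' : (insert p G).Nonempty := Finset.insert_nonempty _ _
        have hlt' : r < (insert p G).min' hne' := by
          rw [Finset.lt_min'_iff]
          simpa using ⟨hrp, hlt⟩
        rw [hmin _ _ (Finset.min'_mem _ hne') (fun q hq => Finset.min'_le _ _ hq), hD, if_neg,
          mul_zero]
        intro hz
        have := hz r hlt'
        rw [Finsupp.tsub_apply, Finsupp.single_eq_of_ne hpr.symm, tsub_zero] at this
        exact Finsupp.mem_support_iff.1 hrs this
      · rfl

/-! ### Graded Betti numbers and regularity -/

/-- The component of homological degree `i` and internal degree `j` of the Koszul resolution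
tensored with the ideal `I`: elements `∑_F f(F) e_F` with `|F| = i` and `f(F) ∈ I` homogeneous of
degree `j - i`. -/
def koszulChains (I : Ideal (MvPolynomial (Fin n) K)) (i j : ℕ) :
    Submodule K (Finset (Fin n) → MvPolynomial (Fin n) K) where
  carrier := {f | ∀ F, f F ∈ I ∧ ∀ a, coeff a (f F) ≠ 0 → F.card = i ∧ a.degree + i = j}
  zero_mem' F := ⟨I.zero_mem, fun a h => absurd (coeff_zero a) h⟩
  add_mem' {f g} hf hg F := by
    refine ⟨I.add_mem (hf F).1 (hg F).1, fun a h => ?_⟩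
    by_cases h1 : coeff a (f F) = 0
    · refine (hg F).2 a fun h2 => h ?_
      rw [Pi.add_apply, coeff_add, h1, h2, add_zero]
    · exact (hf F).2 a h1
  smul_mem' c f hf F := by
    refine ⟨Submodule.smul_of_tower_mem I c (hf F).1, fun a h => (hf F).2 a fun h1 => h ?_⟩
    rw [Pi.smul_apply, coeff_smul, h1, smul_zero]

/-- Cycles of homological degree `i` and internal degree `j`. -/
def koszulCycles (I : Ideal (MvPolynomial (Fin n) K)) (i j : ℕ) :
    Submodule K (Finset (Fin n) → MvPolynomial (Fin n) K) :=
  koszulChains I i j ⊓ LinearMap.ker ((koszulD K n).restrictScalars K)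

/-- Boundaries of homological degree `i` and internal degree `j`. -/
def koszulBoundaries (I : Ideal (MvPolynomial (Fin n) K)) (i j : ℕ) :
    Submodule K (Finset (Fin n) → MvPolynomial (Fin n) K) :=
  (koszulChains I (i + 1) j).map ((koszulD K n).restrictScalars K)

/-- `Tor_i^S(K, I)_j`, computed from the Koszul resolution of `K`: the homology of the component of
internal degree `j` of the Koszul complex tensored with `I`. -/
abbrev GradedTor (I : Ideal (MvPolynomial (Fin n) K)) (i j : ℕ) : Type _ :=
  koszulCycles I i j ⧸ (koszulBoundaries I i j).comap (koszulCycles I i j).subtype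

/-- The graded Betti number `β_{i,j}(I) = dim_K Tor_i^S(K, I)_j`. -/
def gradedBetti (I : Ideal (MvPolynomial (Fin n) K)) (i j : ℕ) : ℕ :=
  Module.finrank K (GradedTor I i j)

/-- `reg I = r`: the maximum of `j - i` over all `i, j` with `β_{i,j}(I) ≠ 0` exists and is `r`. -/
def HasRegularity (I : Ideal (MvPolynomial (Fin n) K)) (r : ℤ) : Prop :=
  IsGreatest {t : ℤ | ∃ i j : ℕ, gradedBetti I i j ≠ 0 ∧ t = (j : ℤ) - (i : ℤ)} r

/-- The degrees `d` such that `(I / 𝔪 I)_d ≠ 0`, where `𝔪 = (x_1, …, x_n)`. -/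
def generatorDegrees (I : Ideal (MvPolynomial (Fin n) K)) : Set ℕ :=
  {d | ∃ f ∈ I, f.IsHomogeneous d ∧ f ∉ Ideal.span (Set.range X) * I}

/-- `I` is equigenerated in degree `d`: the smallest and the largest generator degree of `I` exist
and are both equal to `d`. -/
def IsEquigenerated (I : Ideal (MvPolynomial (Fin n) K)) (d : ℕ) : Prop :=
  IsLeast (generatorDegrees I) d ∧ IsGreatest (generatorDegrees I) d

/-- `I` has linear resolution: for some `d`, it is equigenerated in degree `d` and `reg I = d`. -/
def HasLinearResolution (I : Ideal (MvPolynomial (Fin n) K)) : Prop :=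
  ∃ d : ℕ, IsEquigenerated I d ∧ HasRegularity I d

/-- `I` has differential linear resolution: the iterated gradient ideals `∂^ℓ(I)` have linear
resolution for all `0 ≤ ℓ ≤ α(I)`, where `α(I)` is the smallest generator degree of `I`. -/
def HasDifferentialLinearResolution (I : Ideal (MvPolynomial (Fin n) K)) : Prop :=
  ∃ a : ℕ, IsLeast (generatorDegrees I) a ∧
    ∀ l ≤ a, HasLinearResolution (gradientIdeal^[l] I)

end MonomialGradient

end

namespace MonomialGradient

open MvPolynomial

section

variable {K : Type*} [Field K] {n : ℕ}

/-! ### Monomial ideals -/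

/-! For `I ≠ ⊤` the monomials of `∂^*(I)` are those `x^v` with `x_k x^v ∈ I` for some `k`
(`monomial_mem_starGradientIdeal_iff_exists_add`). An exchange move on `x^v` therefore comes from an
exchange move on `x_k x^v` inside `I`, so both kinds of stability pass to `∂^*(I)`.

The regularity statements rest on `reg I = ω(I)` for stable `I ≠ 0` (`IsStable.hasRegularity`). The
lower bound is `Tor_0`. For the upper bound, the Koszul complex has a contracting homotopy that
divides monomials by their largest variable. In a stable ideal this division does not leave the
ideal once the degree exceeds `ω(I)` (`IsStable.sub_single_mem`), so cycles of internal degree `j >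
ω(I) + i` are boundaries over `I` itself.

Every minimal generator of `∂^*(I)` is a minimal generator of `I` divided by a variable, so its
degree is one less than a generator degree of `I`. This gives the inequality of regularities and, by
iteration, the differential linear resolution. -/

theorem monomial_mem_of_le {I : Ideal (MvPolynomial (Fin n) K)} {u v : Fin n →₀ ℕ}
    (hu : monomial u (1 : K) ∈ I) (huv : u ≤ v) : monomial v (1 : K) ∈ I := by
  have : monomial v (1 : K) = monomial (v - u) 1 * monomial u 1 := by
    rw [monomial_mul, tsub_add_cancel_of_le huv, one_mul]
  rw [this]
  exact I.mul_mem_left _ hu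

theorem IsMonomialIdeal.mem_iff {I : Ideal (MvPolynomial (Fin n) K)} (hI : IsMonomialIdeal I)
    (f : MvPolynomial (Fin n) K) : f ∈ I ↔ ∀ a, coeff a f ≠ 0 → monomial a (1 : K) ∈ I := by
  constructor
  · obtain ⟨A, rfl⟩ := hI
    intro hf a ha
    obtain ⟨u, hu, hua⟩ := mem_ideal_span_monomial_image.1 hf a (mem_support_iff.2 ha)
    exact monomial_mem_of_le (Ideal.subset_span ⟨u, hu, rfl⟩) hua
  · intro h
    rw [f.as_sum]
    refine I.sum_mem fun a ha => ?_
    have : monomial a (coeff a f) = C (coeff a f) * monomial a (1 : K) := by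
      rw [C_mul_monomial, mul_one]
    rw [this]
    exact I.mul_mem_left _ (h a (mem_support_iff.1 ha))

theorem exists_minGens_le {I : Ideal (MvPolynomial (Fin n) K)} {v : Fin n →₀ ℕ}
    (hv : monomial v (1 : K) ∈ I) : ∃ u ∈ minGens I, u ≤ v := by
  obtain ⟨u, huv, hu⟩ := exists_minimal_le_of_wellFoundedLT
    (fun v => monomial v (1 : K) ∈ I) v hv
  exact ⟨u, hu, huv⟩

/-- Dickson's lemma: divisibility is a well quasi-order on monomials, and minimal elements form an
antichain. -/
theorem minGens_finite (I : Ideal (MvPolynomial (Fin n) K)) : (minGens I).Finite :=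
  WellQuasiOrderedLE.finite_of_isAntichain (setOfPred_minimal_antichain _)

theorem IsMonomialIdeal.minGens_nonempty {I : Ideal (MvPolynomial (Fin n) K)}
    (hI : IsMonomialIdeal I) (h0 : I ≠ ⊥) : (minGens I).Nonempty := by
  obtain ⟨f, hf, hf0⟩ := Submodule.exists_mem_ne_zero_of_ne_bot h0
  obtain ⟨a, ha⟩ := exists_coeff_ne_zero hf0
  obtain ⟨u, hu, -⟩ := exists_minGens_le ((hI.mem_iff f).1 hf a ha)
  exact ⟨u, hu⟩

theorem exists_le_sub_single {u v : Fin n →₀ ℕ} (h : u < v) :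
    ∃ i ∈ v.support, u ≤ v - Finsupp.single i 1 := by
  obtain ⟨i, hi⟩ : ∃ i, u i < v i := by
    by_contra! hc
    exact h.not_ge hc
  refine ⟨i, Finsupp.mem_support_iff.2 (by omega), fun k => ?_⟩
  rw [Finsupp.tsub_apply]
  have := h.le k
  rcases eq_or_ne k i with rfl | hk
  · rw [Finsupp.single_eq_same]
    omega
  · rwa [Finsupp.single_eq_of_ne hk, tsub_zero]

theorem single_le_of_mem_support {u : Fin n →₀ ℕ} {i : Fin n} (hi : i ∈ u.support) :
    Finsupp.single i 1 ≤ u :=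
  Finsupp.single_le_iff.2 (Nat.one_le_iff_ne_zero.2 (Finsupp.mem_support_iff.1 hi))

theorem degree_sub_single {u : Fin n →₀ ℕ} {i : Fin n} (hi : i ∈ u.support) :
    (u - Finsupp.single i 1).degree + 1 = u.degree := by
  conv_rhs => rw [← tsub_add_cancel_of_le (single_le_of_mem_support hi), map_add,
    Finsupp.degree_single]

/-! ### Generator degrees of a monomial ideal -/

theorem IsMonomialIdeal.monomial_mem_maximal_mul_iff {I : Ideal (MvPolynomial (Fin n) K)}
    (hI : IsMonomialIdeal I) (b : Fin n →₀ ℕ) :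
    monomial b (1 : K) ∈ Ideal.span (Set.range (X : Fin n → MvPolynomial (Fin n) K)) * I ↔
      ∃ i ∈ b.support, monomial (b - Finsupp.single i 1) (1 : K) ∈ I := by
  constructor
  · intro h
    obtain ⟨A, rfl⟩ := hI
    have : Ideal.span (Set.range (X : Fin n → MvPolynomial (Fin n) K)) *
        Ideal.span ((fun u => monomial u (1 : K)) '' A) ≤ Ideal.span ((fun u => monomial u (1 : K)) ''
          {v | ∃ i, ∃ u ∈ A, v = u + Finsupp.single i 1}) := by
      rw [Ideal.span_mul_span', Ideal.span_le]
      rintro _ ⟨_, ⟨i, rfl⟩, _, ⟨u, hu, rfl⟩, rfl⟩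
      refine Ideal.subset_span ⟨_, ⟨i, u, hu, rfl⟩, ?_⟩
      simp only [X, monomial_mul, mul_one, add_comm]
    obtain ⟨_, ⟨i, u, hu, rfl⟩, hle⟩ := mem_ideal_span_monomial_image.1 (this h) b (by simp)
    refine ⟨i, ?_, monomial_mem_of_le (Ideal.subset_span ⟨u, hu, rfl⟩) (le_tsub_of_add_le_right hle)⟩
    have := hle i
    rw [Finsupp.add_apply, Finsupp.single_eq_same] at this
    exact Finsupp.mem_support_iff.2 (by omega)
  · rintro ⟨i, hi, h⟩
    have : monomial b (1 : K) = X i * monomial (b - Finsupp.single i 1) 1 := by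
      rw [X, monomial_mul, mul_one, add_comm, tsub_add_cancel_of_le (single_le_of_mem_support hi)]
    rw [this]
    exact Ideal.mul_mem_mul (Ideal.subset_span ⟨i, rfl⟩) h

/-- A monomial of `I` lies outside `𝔪I` exactly when no division by a variable stays in `I`, that
is, when it is a minimal generator. This makes `α` and `ω` combinatorial. -/
theorem IsMonomialIdeal.generatorDegrees_eq {I : Ideal (MvPolynomial (Fin n) K)}
    (hI : IsMonomialIdeal I) : generatorDegrees I = Finsupp.degree '' minGens I := by
  ext d
  constructor
  · rintro ⟨f, hf, hd, hfm⟩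
    obtain ⟨b, hb, hbm⟩ : ∃ b, coeff b f ≠ 0 ∧
        monomial b (1 : K) ∉ Ideal.span (Set.range (X : Fin n → MvPolynomial (Fin n) K)) * I := by
      -- If every monomial of `f` were in `𝔪I`, so would be `f`.
      by_contra! hc
      refine hfm ?_
      rw [f.as_sum]
      refine Ideal.sum_mem _ fun a ha => ?_
      have : monomial a (coeff a f) = C (coeff a f) * monomial a (1 : K) := by
        rw [C_mul_monomial, mul_one]
      rw [this]
      exact Ideal.mul_mem_left _ _ (hc a (mem_support_iff.1 ha))
    refine ⟨b, ?_, (Finsupp.degree_eq_weight_one (R := ℕ) ▸ hd hb :)⟩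
    obtain ⟨u, hu, hub⟩ := exists_minGens_le ((hI.mem_iff f).1 hf b hb)
    rcases hub.eq_or_lt with rfl | hlt
    · exact hu
    · obtain ⟨i, hi, hle⟩ := exists_le_sub_single hlt
      exact absurd ((hI.monomial_mem_maximal_mul_iff b).2 ⟨i, hi, monomial_mem_of_le hu.1 hle⟩) hbm
  · rintro ⟨u, hu, rfl⟩
    refine ⟨_, hu.1, isHomogeneous_monomial _ rfl, fun h => ?_⟩
    obtain ⟨i, hi, h⟩ := (hI.monomial_mem_maximal_mul_iff u).1 h
    have := Finsupp.degree_mono (hu.2 h tsub_le_self)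
    have := degree_sub_single hi
    omega

theorem IsMonomialIdeal.exists_isGreatest_generatorDegrees {I : Ideal (MvPolynomial (Fin n) K)}
    (hI : IsMonomialIdeal I) (h0 : I ≠ ⊥) : ∃ w, IsGreatest (generatorDegrees I) w := by
  rw [hI.generatorDegrees_eq]
  have hfin := (minGens_finite I).image Finsupp.degree
  exact ⟨_, (hI.minGens_nonempty h0).image _ |>.csSup_mem hfin,
    fun _ h => le_csSup hfin.bddAbove h⟩

theorem minGens_top : minGens (⊤ : Ideal (MvPolynomial (Fin n) K)) = {0} := by
  ext u
  simp [minGens, bot_eq_zero]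

theorem generatorDegrees_top :
    generatorDegrees (⊤ : Ideal (MvPolynomial (Fin n) K)) = {0} := by
  have hI : IsMonomialIdeal (⊤ : Ideal (MvPolynomial (Fin n) K)) :=
    ⟨{0}, by simp⟩
  rw [hI.generatorDegrees_eq, minGens_top, Set.image_singleton, map_zero]

theorem isEquigenerated_iff {I : Ideal (MvPolynomial (Fin n) K)} {d : ℕ} :
    IsEquigenerated I d ↔ generatorDegrees I = {d} := by
  constructor
  · rintro ⟨h1, h2⟩
    exact Set.eq_singleton_iff_unique_mem.2 ⟨h1.1, fun e he => le_antisymm (h2.2 he) (h1.2 he)⟩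
  · intro h
    simp [IsEquigenerated, h]

/-! ### Gradient ideals of stable ideals -/

theorem isMonomialIdeal_starGradientIdeal (I : Ideal (MvPolynomial (Fin n) K)) :
    IsMonomialIdeal (starGradientIdeal I) := by
  refine ⟨{v | ∃ u ∈ minGens I, ∃ i ∈ u.support, v = u - Finsupp.single i 1}, ?_⟩
  unfold starGradientIdeal
  congr 1
  ext f
  constructor
  · rintro ⟨u, hu, i, hi, rfl⟩
    exact ⟨_, ⟨u, hu, i, hi, rfl⟩, rfl⟩
  · rintro ⟨_, ⟨u, hu, i, hi, rfl⟩, rfl⟩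
    exact ⟨u, hu, i, hi, rfl⟩

theorem monomial_mem_starGradientIdeal_iff {I : Ideal (MvPolynomial (Fin n) K)}
    (v : Fin n →₀ ℕ) : monomial v (1 : K) ∈ starGradientIdeal I ↔
      ∃ u ∈ minGens I, ∃ i ∈ u.support, u - Finsupp.single i 1 ≤ v := by
  constructor
  · intro h
    have : starGradientIdeal I = Ideal.span ((fun u => monomial u (1 : K)) ''
        {v | ∃ u ∈ minGens I, ∃ i ∈ u.support, v = u - Finsupp.single i 1}) := by
      unfold starGradientIdeal
      congr 1
      aesop
    rw [this] at h
    obtain ⟨_, ⟨u, hu, i, hi, rfl⟩, hle⟩ := mem_ideal_span_monomial_image.1 h v (by simp)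
    exact ⟨u, hu, i, hi, hle⟩
  · rintro ⟨u, hu, i, hi, hle⟩
    exact monomial_mem_of_le (Ideal.subset_span ⟨u, hu, i, hi, rfl⟩) hle

/-- A monomial `x^v` lies in `∂^*(I)` if and only if `x_i x^v ∈ I` for some `i`. -/
theorem monomial_mem_starGradientIdeal_iff_exists_add {I : Ideal (MvPolynomial (Fin n) K)}
    (h1 : I ≠ ⊤) (v : Fin n →₀ ℕ) : monomial v (1 : K) ∈ starGradientIdeal I ↔
      ∃ i, monomial (v + Finsupp.single i 1) (1 : K) ∈ I := by
  rw [monomial_mem_starGradientIdeal_iff]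
  constructor
  · rintro ⟨u, hu, i, -, hle⟩
    exact ⟨i, monomial_mem_of_le hu.1 (tsub_le_iff_right.1 hle)⟩
  · rintro ⟨i, h⟩
    obtain ⟨u, hu, hle⟩ := exists_minGens_le h
    by_cases hi : i ∈ u.support
    · exact ⟨u, hu, i, hi, tsub_le_iff_right.2 hle⟩
    -- Here `x_i` does not divide `x^u`, so `x^u` already divides `x^v`, and dividing it by any of
    -- its variables will do. Such a variable exists because `I` is proper.
    · have hu0 : u ≠ 0 := by
        rintro rfl
        exact h1 (I.eq_top_iff_one.2 hu.1)
      obtain ⟨j, hj⟩ := Finsupp.support_nonempty_iff.2 hu0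
      refine ⟨u, hu, j, hj, tsub_le_self.trans fun k => ?_⟩
      have := hle k
      rcases eq_or_ne k i with rfl | hk
      · rw [Finsupp.notMem_support_iff.1 hi]
        exact Nat.zero_le _
      · rwa [Finsupp.add_apply, Finsupp.single_eq_of_ne hk, add_zero] at this

/-- The sole generator `1` is divisible by no variable. The unit ideal is a separate case below
because the description by `x_i x^v ∈ I` fails for it. -/
theorem starGradientIdeal_top : starGradientIdeal (⊤ : Ideal (MvPolynomial (Fin n) K)) = ⊥ := by
  simp [starGradientIdeal, minGens_top]

theorem isStable_bot : IsStable (⊥ : Ideal (MvPolynomial (Fin n) K)) :=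
  ⟨⟨∅, by simp⟩, fun u hu => by simp at hu⟩

theorem isStronglyStable_bot : IsStronglyStable (⊥ : Ideal (MvPolynomial (Fin n) K)) :=
  ⟨⟨∅, by simp⟩, fun u hu => by simp at hu⟩

theorem sub_single_add_single_add {v : Fin n →₀ ℕ} {m : Fin n} (hm : m ∈ v.support)
    (i k : Fin n) : v + Finsupp.single k 1 - Finsupp.single m 1 + Finsupp.single i 1
      = v - Finsupp.single m 1 + Finsupp.single i 1 + Finsupp.single k 1 := by
  rw [← tsub_add_eq_add_tsub (single_le_of_mem_support hm), add_right_comm]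

/-- Take `x_k x^v ∈ I` and `m = max(v)`. Which exchange in `I` is available depends on whether `x_m`
or `x_k` is the largest variable of `x_k x^v`. -/
theorem IsStable.starGradientIdeal {I : Ideal (MvPolynomial (Fin n) K)} (hI : IsStable I) :
    IsStable (starGradientIdeal I) := by
  rcases eq_or_ne I ⊤ with rfl | h1
  · rw [starGradientIdeal_top]
    exact isStable_bot
  refine ⟨isMonomialIdeal_starGradientIdeal I, fun v hv m hm i hi => ?_⟩
  rw [monomial_mem_starGradientIdeal_iff_exists_add h1] at hv ⊢
  obtain ⟨k, hk⟩ := hv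
  have hmv : m ∈ v.support := hm.1
  rcases le_or_gt k m with hkm | hmk
  -- For `k ≤ m` the largest variable is still `x_m`, and the exchange commutes with multiplication
  -- by `x_k`.
  · refine ⟨k, ?_⟩
    rw [← sub_single_add_single_add hmv]
    refine hI.exchange _ hk m ⟨?_, fun q hq => ?_⟩ i hi
    · exact Finsupp.support_mono le_self_add hmv
    · rcases eq_or_ne q k with rfl | hqk
      · exact hkm
      · refine hm.2 ?_
        simpa [Finsupp.single_eq_of_ne hqk] using hq
  -- For `k > m`, exchanging `x_k` for `x_i` gives `x_i x^v = x_m · x_i (x^v / x_m) ∈ I`, so the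
  -- witness is now `m`.
  · refine ⟨m, ?_⟩
    have := hI.exchange _ hk k ⟨by simp, fun q hq => ?_⟩ i (hi.trans hmk)
    · rw [add_tsub_cancel_right] at this
      rwa [add_right_comm, tsub_add_cancel_of_le (single_le_of_mem_support hmv)]
    · rcases eq_or_ne q k with rfl | hqk
      · exact le_rfl
      · refine (hm.2 ?_).trans hmk.le
        simpa [Finsupp.single_eq_of_ne hqk] using hq

theorem IsStronglyStable.starGradientIdeal {I : Ideal (MvPolynomial (Fin n) K)}
    (hI : IsStronglyStable I) : IsStronglyStable (starGradientIdeal I) := by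
  rcases eq_or_ne I ⊤ with rfl | h1
  · rw [starGradientIdeal_top]
    exact isStronglyStable_bot
  refine ⟨isMonomialIdeal_starGradientIdeal I, fun v hv j hj i hi => ?_⟩
  rw [monomial_mem_starGradientIdeal_iff_exists_add h1] at hv ⊢
  obtain ⟨k, hk⟩ := hv
  refine ⟨k, ?_⟩
  rw [← sub_single_add_single_add hj]
  exact hI.exchange _ hk j (Finsupp.support_mono le_self_add hj) i hi

theorem IsStronglyStable.isStable {I : Ideal (MvPolynomial (Fin n) K)}
    (hI : IsStronglyStable I) : IsStable I :=
  ⟨hI.isMonomialIdeal, fun u hu m hm i hi => hI.exchange u hu m hm.1 i hi⟩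

theorem IsMonomialIdeal.starGradientIdeal_ne_bot {I : Ideal (MvPolynomial (Fin n) K)}
    (hI : IsMonomialIdeal I) (h0 : I ≠ ⊥) (h1 : I ≠ ⊤) : starGradientIdeal I ≠ ⊥ := by
  obtain ⟨u, hu⟩ := hI.minGens_nonempty h0
  have hu0 : u ≠ 0 := by
    rintro rfl
    exact h1 (I.eq_top_iff_one.2 hu.1)
  obtain ⟨i, hi⟩ := Finsupp.support_nonempty_iff.2 hu0
  have : monomial (u - Finsupp.single i 1) (1 : K) ∈ starGradientIdeal I :=
    Ideal.subset_span ⟨u, hu, i, hi, rfl⟩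
  intro h
  rw [h] at this
  simp at this

theorem IsMonomialIdeal.succ_mem_generatorDegrees {I : Ideal (MvPolynomial (Fin n) K)}
    (hI : IsMonomialIdeal I) {d : ℕ}
    (hd : d ∈ generatorDegrees (starGradientIdeal I)) : d + 1 ∈ generatorDegrees I := by
  rw [(isMonomialIdeal_starGradientIdeal I).generatorDegrees_eq] at hd
  obtain ⟨v, hv, rfl⟩ := hd
  obtain ⟨u, hu, i, hi, hle⟩ := (monomial_mem_starGradientIdeal_iff v).1 hv.1
  have : v = u - Finsupp.single i 1 :=
    le_antisymm (hv.2 (Ideal.subset_span ⟨u, hu, i, hi, rfl⟩) hle) hle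
  rw [hI.generatorDegrees_eq]
  exact ⟨u, hu, by rw [this, degree_sub_single hi]⟩

/-! ### The regularity of a stable ideal -/

/-- By degree, some minimal generator divides `x^u` properly, so `x^u / x_p ∈ I` for some `p`. If `p
< m`, then `x_m` is still the largest variable of `x^u / x_p`, and exchanging it for `x_p` yields
`x^u / x_m`. -/
theorem IsStable.sub_single_mem {I : Ideal (MvPolynomial (Fin n) K)} (hI : IsStable I) {w : ℕ}
    (hw : w ∈ upperBounds (generatorDegrees I)) {u : Fin n →₀ ℕ} (hu : monomial u (1 : K) ∈ I)
    (hd : w < u.degree) {m : Fin n} (hm : IsGreatest (u.support : Set (Fin n)) m) :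
    monomial (u - Finsupp.single m 1) (1 : K) ∈ I := by
  obtain ⟨g, hg, hgu⟩ := exists_minGens_le hu
  have hgw : g.degree ≤ w := by
    rw [hI.isMonomialIdeal.generatorDegrees_eq] at hw
    exact hw ⟨g, hg, rfl⟩
  obtain ⟨p, hp, hgp⟩ := exists_le_sub_single (hgu.lt_of_ne (by rintro rfl; omega))
  have hmem := monomial_mem_of_le hg.1 hgp
  rcases (hm.2 hp).eq_or_lt with rfl | hlt
  · exact hmem
  · have := hI.exchange _ hmem m ⟨?_, fun q hq => hm.2 ?_⟩ p hlt
    · have hmp : Finsupp.single m 1 ≤ u - Finsupp.single p 1 := by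
        refine single_le_of_mem_support ?_
        have := Finsupp.mem_support_iff.1 hm.1
        simpa [Finsupp.single_eq_of_ne hlt.ne'] using this
      rwa [tsub_add_eq_add_tsub hmp, tsub_add_cancel_of_le (single_le_of_mem_support hp)] at this
    · have := Finsupp.mem_support_iff.1 hm.1
      simpa [Finsupp.single_eq_of_ne hlt.ne'] using this
    · have hq := Finsupp.mem_support_iff.1 hq
      rw [Finsupp.tsub_apply] at hq
      exact Finsupp.mem_support_iff.2 (by omega)

/-! ### The largest-variable homotopy and exactness in high degrees -/

/-- Division by `x_p` of those terms whose largest variable is `x_p`. -/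
theorem exists_koszulDivMax (p : Fin n) (g : MvPolynomial (Fin n) K) :
    ∃ h : MvPolynomial (Fin n) K, ∀ a : Fin n →₀ ℕ,
      coeff a h = if ∀ q, p < q → a q = 0 then coeff (a + Finsupp.single p 1) g else 0 := by
  classical
  refine ⟨∑ b ∈ g.support, if b p ≠ 0 ∧ ∀ q, p < q → b q = 0 then
    monomial (b - Finsupp.single p 1) (coeff b g) else 0, fun a => ?_⟩
  rw [coeff_sum]
  have hap : (a + Finsupp.single p 1 : Fin n →₀ ℕ) p ≠ 0 := by simp
  have haq : (∀ q, p < q → (a + Finsupp.single p 1 : Fin n →₀ ℕ) q = 0) ↔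
      ∀ q, p < q → a q = 0 := by
    refine forall₂_congr fun q hq => ?_
    rw [Finsupp.add_apply, Finsupp.single_eq_of_ne hq.ne', add_zero]
  rw [Finset.sum_eq_single (a + Finsupp.single p 1)]
  · rw [apply_ite (coeff a), coeff_monomial, add_tsub_cancel_right, if_pos rfl, coeff_zero]
    simp only [haq, hap, ne_eq, not_false_eq_true, true_and]
  · intro b _ hne
    split_ifs with hb
    · rw [coeff_monomial, if_neg]
      rintro rfl
      refine hne ?_
      rw [tsub_add_cancel_of_le]
      exact Finsupp.single_le_iff.2 (Nat.one_le_iff_ne_zero.2 hb.1)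
    · exact coeff_zero _
  · intro h
    rw [notMem_support_iff.1 h]
    simp

/-- The contracting homotopy of the Koszul complex that divides by the largest variable: a cycle
without constant term is the boundary of its image. -/
theorem exists_koszulHomotopy (f : Finset (Fin n) → MvPolynomial (Fin n) K)
    (hf : koszulD K n f = 0) (hf0 : coeff 0 (f ∅) = 0) :
    ∃ H : Finset (Fin n) → MvPolynomial (Fin n) K, koszulD K n H = f ∧
      ∀ G a, coeff a (H G) ≠ 0 → ∃ p ∈ G, (∀ q, p < q → a q = 0) ∧
        coeff (a + Finsupp.single p 1) (f (G.erase p)) ≠ 0 := by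
  choose D hD using exists_koszulDivMax (K := K) (n := n)
  -- With `p = max G`, all of `G \ {p}` lies below `p`, so the sign `(-1)^|G \ {p}|` cancels the
  -- Koszul sign of removing `p`.
  obtain ⟨H, hmax, hempty⟩ : ∃ H : Finset (Fin n) → MvPolynomial (Fin n) K, (∀ G, ∀ p ∈ G,
      (∀ q ∈ G, q ≤ p) → H G = C ((-1) ^ (G.erase p).card) * D p (f (G.erase p))) ∧ H ∅ = 0 := by
    refine ⟨fun G => if h : G.Nonempty then
      C ((-1) ^ (G.erase (G.max' h)).card) * D (G.max' h) (f (G.erase (G.max' h))) else 0,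
      ?_, by simp⟩
    intro G p hp hle
    have hG : G.Nonempty := ⟨p, hp⟩
    have : G.max' hG = p := le_antisymm (Finset.max'_le _ _ _ hle) (Finset.le_max' _ _ hp)
    simp only [dif_pos hG, this]
  refine ⟨H, ?_, fun G a hne => ?_⟩
  swap
  · rcases G.eq_empty_or_nonempty with rfl | hG
    · simp [hempty] at hne
    · refine ⟨G.max' hG, Finset.max'_mem _ _, ?_⟩
      rw [hmax G _ (Finset.max'_mem _ hG) fun q hq => Finset.le_max' _ _ hq, coeff_C_mul, hD] at hne
      split_ifs at hne with h
      · exact ⟨h, right_ne_zero_of_mul hne⟩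
      · simp at hne
  funext G
  ext a
  rw [coeff_koszulD]
  rcases (G ∪ a.support).eq_empty_or_nonempty with h0 | hne
  · rw [Finset.union_eq_empty, Finsupp.support_eq_empty] at h0
    obtain ⟨rfl, rfl⟩ := h0
    simp [hf0]
  obtain ⟨r, hr, hrmax⟩ : ∃ r ∈ G ∪ a.support, ∀ q ∈ G ∪ a.support, q ≤ r :=
    ⟨_, Finset.max'_mem _ hne, fun q hq => Finset.le_max' _ _ hq⟩
  have hra : ∀ q, r < q → a q = 0 := by
    intro q hq
    by_contra h
    exact (hrmax q (Finset.mem_union_right _ (Finsupp.mem_support_iff.2 h))).not_gt hq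
  have hrG : ∀ q ∈ G, q ≤ r := fun q hq => hrmax q (Finset.mem_union_left _ hq)
  by_cases hrmem : r ∈ G
  -- The largest index `r` lies in `G`. The cycle condition at `e_{G \ {r}}` and `x_r x^a` writes
  -- the wanted coefficient of `f` through those at `insert p (G \ {r})` with `p ∉ G`, which are, up
  -- to sign, the coefficients of `H` in the boundary.
  · have e := congrArg (coeff (a + Finsupp.single r 1)) (congrFun hf (G.erase r))
    rw [coeff_koszulD, Finset.compl_erase, Finset.sum_insert (by simpa using hrmem)] at e
    have hfil : (G.erase r).filter (· < r) = G.erase r := by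
      refine Finset.filter_true_of_mem fun q hq => ?_
      rw [Finset.mem_erase] at hq
      exact lt_of_le_of_ne (hrG q hq.2) hq.1
    rw [if_pos (by simp), Finset.insert_erase hrmem, add_tsub_cancel_right, hfil] at e
    simp only [Pi.zero_apply, coeff_zero] at e
    have hsq : ((-1 : K) ^ (G.erase r).card) * (-1) ^ (G.erase r).card = 1 := by
      rw [← mul_pow, neg_one_mul, neg_neg, one_pow]
    refine mul_left_cancel₀ (left_ne_zero_of_mul_eq_one hsq) ?_
    rw [eq_neg_of_add_eq_zero_left e, ← Finset.sum_neg_distrib, Finset.mul_sum]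
    refine Finset.sum_congr rfl fun p hp => ?_
    have hpG : p ∉ G := Finset.mem_compl.1 hp
    have hpr : p ≠ r := fun h => hpG (h ▸ hrmem)
    have hsupp : p ∈ (a + Finsupp.single r 1).support ↔ p ∈ a.support := by
      simp [Finsupp.single_eq_of_ne hpr]
    simp only [hsupp]
    split_ifs with hpa
    · have hrp : p < r := lt_of_le_of_ne (hrmax p (Finset.mem_union_right _ hpa)) hpr
      rw [hmax (insert p G) r (Finset.mem_insert_of_mem hrmem)
        (by simpa using ⟨hrp.le, hrG⟩), coeff_C_mul, hD, if_pos, Finset.erase_insert_of_ne hpr]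
      · have h1 : G.filter (· < p) = (G.erase r).filter (· < p) := by
          ext q
          by_cases hq : q = r
          · simp [hq, hrp.le]
          · simp [hq]
        have h2 : a - Finsupp.single p 1 + Finsupp.single r 1
            = a + Finsupp.single r 1 - Finsupp.single p 1 :=
          tsub_add_eq_add_tsub (single_le_of_mem_support hpa)
        rw [h1, Finset.card_insert_of_notMem (by simp [hpG]), h2, pow_succ]
        linear_combination -((-1) ^ ((G.erase r).filter (· < p)).card *
          coeff (a + Finsupp.single r 1 - Finsupp.single p 1) (f (insert p (G.erase r)))) * hsq
      · intro q hq
        rw [Finsupp.tsub_apply, hra q hq, zero_tsub]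
    · rw [mul_zero, neg_zero]
  · have hrs : r ∈ a.support := (Finset.mem_union.1 hr).resolve_left hrmem
    have hlt : ∀ q ∈ G, q < r := fun q hq =>
      lt_of_le_of_ne (hrG q hq) fun h => hrmem (h ▸ hq)
    -- Now `r` occurs only in `x^a`. Only `p = r` contributes: for other `p`, the monomial `x^a /
    -- x_p` still contains `x_r`, with `r` above all of `insert p G`, so the division returns zero.
    rw [Finset.sum_eq_single_of_mem r (Finset.mem_compl.2 hrmem)]
    · rw [if_pos hrs, hmax (insert r G) r (Finset.mem_insert_self _ _) (by simpa using hrG),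
        coeff_C_mul, hD, if_pos, Finset.erase_insert hrmem,
        tsub_add_cancel_of_le (single_le_of_mem_support hrs), Finset.filter_true_of_mem hlt,
        ← mul_assoc, ← mul_pow, neg_one_mul, neg_neg, one_pow, one_mul]
      intro q hq
      rw [Finsupp.tsub_apply, hra q hq, zero_tsub]
    · intro p hp hpr
      split_ifs with hpa
      · have hrp : p < r := lt_of_le_of_ne (hrmax p (Finset.mem_union_right _ hpa)) hpr
        have hne' : (insert p G).Nonempty := Finset.insert_nonempty _ _
        have hlt' : (insert p G).max' hne' < r := by
          rw [Finset.max'_lt_iff]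
          simpa using ⟨hrp, hlt⟩
        rw [hmax _ _ (Finset.max'_mem _ hne') (fun q hq => Finset.le_max' _ _ hq), coeff_C_mul, hD,
          if_neg, mul_zero, mul_zero]
        intro hz
        have := hz r hlt'
        rw [Finsupp.tsub_apply, Finsupp.single_eq_of_ne hpr.symm, tsub_zero] at this
        exact Finsupp.mem_support_iff.1 hrs this
      · rfl

/-- Above the largest generator degree, the Koszul complex tensored with a stable ideal is exact. -/
theorem IsStable.koszulCycles_le_koszulBoundaries {I : Ideal (MvPolynomial (Fin n) K)}
    (hI : IsStable I) {w : ℕ} (hw : w ∈ upperBounds (generatorDegrees I)) {i j : ℕ}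
    (hij : w + i < j) : koszulCycles I i j ≤ koszulBoundaries I i j := by
  rintro f ⟨hf, hdf⟩
  -- A nonzero constant term would force `j = i`, against `w + i < j`.
  obtain ⟨H, rfl, hH⟩ := exists_koszulHomotopy f hdf <| by
    by_contra h
    have := (hf ∅).2 0 h
    rw [map_zero] at this
    omega
  refine ⟨H, fun G => ⟨(hI.isMonomialIdeal.mem_iff _).2 fun a ha => ?_, fun a ha => ?_⟩, rfl⟩
  · obtain ⟨p, -, hpa, hne⟩ := hH G a ha
    have hdeg := (hf (G.erase p)).2 _ hne
    have hmem := (hI.isMonomialIdeal.mem_iff _).1 (hf (G.erase p)).1 _ hne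
    -- The monomial `x^a x_p ∈ I` has degree `j - i > w` and largest variable `x_p`.
    have := hI.sub_single_mem hw hmem (by omega) (m := p) ⟨by simp, fun q hq => ?_⟩
    · rwa [add_tsub_cancel_right] at this
    · by_contra! hlt
      refine Finsupp.mem_support_iff.1 hq ?_
      rw [Finsupp.add_apply, hpa q hlt, Finsupp.single_eq_of_ne hlt.ne', add_zero]
  · obtain ⟨p, hp, -, hne⟩ := hH G a ha
    have hdeg := (hf (G.erase p)).2 _ hne
    rw [map_add, Finsupp.degree_single, Finset.card_erase_of_mem hp] at hdeg
    have := Finset.card_pos.2 ⟨p, hp⟩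
    omega

/-! ### Finite-dimensionality and graded Betti numbers -/

/-- Chains are determined by their finitely many coefficients of degree at most `j`. Finiteness
matters because `finrank` is zero on infinite-dimensional spaces, so otherwise a zero Betti number
would not mean that `Tor` vanishes. -/
instance finite_koszulChains (I : Ideal (MvPolynomial (Fin n) K)) (i j : ℕ) :
    Module.Finite K (koszulChains I i j) := by
  have hfin := Finsupp.finite_of_degree_le (σ := Fin n) j
  have := hfin.to_subtype
  let φ : koszulChains I i j →ₗ[K]
      (Finset (Fin n) × {a : Fin n →₀ ℕ | a.degree ≤ j} → K) :=
    { toFun := fun f x => coeff x.2.1 (f.1 x.1)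
      map_add' := fun f g => by
        funext x
        simp
      map_smul' := fun c f => by
        funext x
        simp }
  refine Module.Finite.of_injective φ fun f g h => ?_
  ext G a
  by_cases ha : a.degree ≤ j
  · exact congrFun h (G, ⟨a, ha⟩)
  · have key : ∀ f : koszulChains I i j, coeff a (f.1 G) = 0 := fun f => by
      by_contra hc
      have := ((f.2 G).2 a hc).2
      omega
    rw [key f, key g]

instance finite_gradedTor (I : Ideal (MvPolynomial (Fin n) K)) (i j : ℕ) :
    Module.Finite K (GradedTor I i j) := by
  have : Module.Finite K (koszulCycles I i j) :=
    Submodule.finiteDimensional_of_le (S₂ := koszulChains I i j) inf_le_left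
  infer_instance

theorem gradedBetti_eq_zero_iff (I : Ideal (MvPolynomial (Fin n) K)) (i j : ℕ) :
    gradedBetti I i j = 0 ↔ koszulCycles I i j ≤ koszulBoundaries I i j := by
  rw [gradedBetti, Module.finrank_zero_iff, Submodule.Quotient.subsingleton_iff,
    Submodule.comap_subtype_eq_top]

/-- If `f ∈ I` is not in `𝔪I`, then `f e_∅` is a cycle but not a boundary, since the `e_∅`-component
of a boundary lies in `𝔪I`. -/
theorem gradedBetti_zero_ne_zero {I : Ideal (MvPolynomial (Fin n) K)}
    {d : ℕ} (hd : d ∈ generatorDegrees I) : gradedBetti I 0 d ≠ 0 := by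
  classical
  rw [Ne, gradedBetti_eq_zero_iff]
  intro hle
  obtain ⟨f, hf, hfd, hfm⟩ := hd
  have hc : (Pi.single ∅ f : Finset (Fin n) → MvPolynomial (Fin n) K) ∈ koszulCycles I 0 d := by
    refine ⟨fun F => ?_, ?_⟩
    · rcases eq_or_ne F ∅ with rfl | hF
      · rw [Pi.single_eq_same]
        refine ⟨hf, fun a ha => ⟨rfl, ?_⟩⟩
        rw [add_zero]
        exact (Finsupp.degree_eq_weight_one (R := ℕ) ▸ hfd ha :)
      · rw [Pi.single_eq_of_ne hF]
        exact ⟨I.zero_mem, fun a ha => absurd (coeff_zero a) ha⟩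
    · change koszulD K n _ = 0
      funext G
      rw [koszulD_apply]
      refine Finset.sum_eq_zero fun p _ => ?_
      rw [Pi.single_eq_of_ne (Finset.insert_ne_empty _ _), mul_zero]
  obtain ⟨g, hg, hgf⟩ := hle hc
  refine hfm ?_
  have e : koszulD K n g ∅ = f := by
    have := congrFun hgf ∅
    rwa [Pi.single_eq_same] at this
  rw [← e, koszulD_apply]
  refine Ideal.sum_mem _ fun p _ => ?_
  rw [mul_assoc]
  exact Ideal.mul_mem_left _ _ (Ideal.mul_mem_mul (Ideal.subset_span ⟨p, rfl⟩) (hg _).1)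

/-- The regularity of a stable ideal is its largest generator degree. -/
theorem IsStable.hasRegularity {I : Ideal (MvPolynomial (Fin n) K)} (hI : IsStable I) {w : ℕ}
    (hw : IsGreatest (generatorDegrees I) w) : HasRegularity I w := by
  refine ⟨⟨0, w, gradedBetti_zero_ne_zero hw.1, by simp⟩, ?_⟩
  rintro t ⟨i, j, hb, rfl⟩
  by_contra! hlt
  exact hb ((gradedBetti_eq_zero_iff I i j).2
    (hI.koszulCycles_le_koszulBoundaries hw.2 (by omega)))

/-! ### Linear resolutions of iterated gradient ideals -/

theorem IsStable.hasLinearResolution {I : Ideal (MvPolynomial (Fin n) K)} (hI : IsStable I)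
    {d : ℕ} (hd : IsEquigenerated I d) : HasLinearResolution I :=
  ⟨d, hd, hI.hasRegularity hd.2⟩

/-- Generator degrees drop by exactly one, so `d` is the only candidate. It occurs because `∂^*(I) ≠
0`, where the positive degree `d + 1` excludes `I = S`. -/
theorem IsStable.isEquigenerated_starGradientIdeal {I : Ideal (MvPolynomial (Fin n) K)}
    (hI : IsStable I) {d : ℕ} (hd : IsEquigenerated I (d + 1)) :
    IsEquigenerated (MonomialGradient.starGradientIdeal I) d := by
  rw [isEquigenerated_iff] at hd ⊢
  have h0 : I ≠ ⊥ := by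
    rintro rfl
    obtain ⟨f, hf, -, hfm⟩ := hd.ge (Set.mem_singleton (d + 1))
    rw [Ideal.mem_bot.1 hf] at hfm
    exact hfm (Ideal.zero_mem _)
  have h1 : I ≠ ⊤ := by
    rintro rfl
    rw [generatorDegrees_top] at hd
    simp at hd
  obtain ⟨w, hw⟩ := hI.starGradientIdeal.isMonomialIdeal.exists_isGreatest_generatorDegrees
    (hI.isMonomialIdeal.starGradientIdeal_ne_bot h0 h1)
  have key : ∀ e ∈ generatorDegrees (MonomialGradient.starGradientIdeal I), e = d := fun e he => by
    have := hI.isMonomialIdeal.succ_mem_generatorDegrees he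
    rw [hd] at this
    simpa using this
  exact Set.eq_singleton_iff_unique_mem.2 ⟨key w hw.1 ▸ hw.1, key⟩

theorem IsStable.hasDifferentialLinearResolution {I : Ideal (MvPolynomial (Fin n) K)}
    (hI : IsStable I) {d : ℕ} (hd : IsEquigenerated I d)
    (h : ∀ l < d, gradientIdeal (gradientIdeal^[l] I) =
      MonomialGradient.starGradientIdeal (gradientIdeal^[l] I)) :
    HasDifferentialLinearResolution I := by
  -- The degree `e` of `∂^l(I)` is tied to `l` by `l + e = d`. The last gradient step goes from
  -- degree `1` to degree `0`, so `∂ = ∂^*` is needed only for `l < d`.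
  have key : ∀ l e, l + e = d →
      IsStable (gradientIdeal^[l] I) ∧ IsEquigenerated (gradientIdeal^[l] I) e := by
    intro l
    induction l with
    | zero =>
      intro e he
      obtain rfl : e = d := by omega
      exact ⟨hI, hd⟩
    | succ l ih =>
      intro e he
      obtain ⟨h1, h2⟩ := ih (e + 1) (by omega)
      rw [Function.iterate_succ_apply', h l (by omega)]
      exact ⟨h1.starGradientIdeal, h1.isEquigenerated_starGradientIdeal h2⟩
  refine ⟨d, hd.1, fun l hl => ?_⟩
  obtain ⟨h1, h2⟩ := key l (d - l) (by omega)
  exact h1.hasLinearResolution h2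

end

end MonomialGradient

theorem proposition3p4 {K : Type*} [Field K] (n : ℕ) (I : Ideal (MvPolynomial (Fin n) K))
    (hI : MonomialGradient.gradientIdeal I = MonomialGradient.starGradientIdeal I) :
    -- the gradient ideal of a stable ideal is stable
    (MonomialGradient.IsStable I →
      MonomialGradient.IsStable (MonomialGradient.gradientIdeal I)) ∧
    -- the gradient ideal of a strongly stable ideal is strongly stable
    (MonomialGradient.IsStronglyStable I →
      MonomialGradient.IsStronglyStable (MonomialGradient.gradientIdeal I)) ∧
    -- `reg ∂(I) ≤ reg I`
    (MonomialGradient.IsStable I ∨ MonomialGradient.IsStronglyStable I → I ≠ ⊥ → I ≠ ⊤ →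
      ∃ r s : ℤ, MonomialGradient.HasRegularity (MonomialGradient.gradientIdeal I) r ∧
        MonomialGradient.HasRegularity I s ∧ r ≤ s) ∧
    -- equigenerated (strongly) stable ideals have differential linear resolution
    (MonomialGradient.IsStable I ∨ MonomialGradient.IsStronglyStable I →
      ∀ d : ℕ, MonomialGradient.IsEquigenerated I d →
        (∀ l < d, MonomialGradient.gradientIdeal (MonomialGradient.gradientIdeal^[l] I) =
          MonomialGradient.starGradientIdeal (MonomialGradient.gradientIdeal^[l] I)) →
        MonomialGradient.HasDifferentialLinearResolution I) := by
  refine ⟨fun h => hI ▸ h.starGradientIdeal, fun h => hI ▸ h.starGradientIdeal,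
    fun h h0 h1 => ?_, fun h d hd hl => ?_⟩
  · have hs : MonomialGradient.IsStable I := h.elim id fun h => h.isStable
    have hs' := hs.starGradientIdeal
    obtain ⟨s, hs1⟩ := hs.isMonomialIdeal.exists_isGreatest_generatorDegrees h0
    obtain ⟨r, hr1⟩ := hs'.isMonomialIdeal.exists_isGreatest_generatorDegrees
      (hs.isMonomialIdeal.starGradientIdeal_ne_bot h0 h1)
    have hle := hs1.2 (hs.isMonomialIdeal.succ_mem_generatorDegrees hr1.1)
    exact ⟨r, s, hI ▸ hs'.hasRegularity hr1, hs.hasRegularity hs1, by omega⟩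
  · have hs : MonomialGradient.IsStable I := h.elim id fun h => h.isStable
    exact hs.hasDifferentialLinearResolution hd hl
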